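/- Let $n,D$ be natural numbers. For a density matrix $\sigma^*$ of one qubit and $0<\gamma\le 1$ let $\mathcal N$ be the replacement channel, i.e. the linear map $\mathcal N(Y)=(1-\gamma)Y+\gamma\,\mathrm{Tr}(Y)\,\sigma^*$ on $2\times 2$ complex matrices (so $\mathcal N(\rho)=(1-\gamma)\rho+\gamma\sigma^*$ on states). For unitaries $U_1,\dots,U_D\in U(2^n)$ write $\mathcal U_k(X)=U_kXU_k^\dagger$ and let $$\mathcal C=\mathcal N^{\otimes n}\circ\mathcal U_D\circ\cdots\circ\mathcal N^{\otimes n}\circ\mathcal U_1$$ be the noisy $n$-qubit circuit of depth $D$. Let $U_1,\dots,U_D$ be independent and distributed according to the Haar probability measure of $U(2^n)$, let $\mathbb E$ be the expectation over them, and let $\|X\|_1=\mathrm{Tr}\sqrt{X^\dagger X}$. There is an absolute constant $C>0$ such that the following holds. (1) For all $0<\gamma\le 1$, all one-qubit states $\sigma^*$, all $n$, all $D>1$ and all orthogonal pure $n$-qubit states $\rho=|\psi\rangle\langle\psi|$ and $\sigma=|\varphi\rangle\langle\varphi|$ (with unit vectors $\psi\perp\varphi$), the trace distance $\frac12\|\mathcal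 C(\rho-\sigma)\|_1$ is integrable and $$\frac12\,\mathbb E\,\|\mathcal C(\rho-\sigma)\|_1\le C\,2^{n/2}\Bigl(1-\frac\gamma2\Bigr)^{n(D-1)/2}.$$ (2) Consequently the outputs forget the inputs after a constant depth: for every $0<\gamma\le1$ there is $c>0$, depending only on $\gamma$, such that for all one-qubit states $\sigma^*$, all $n$, all $D>1-1/\log_2(1-\gamma/2)$ and all orthogonal pure $n$-qubit states $\rho,\sigma$, $$\frac12\,\mathbb E\,\|\mathcal C(\rho-\sigma)\|_1\le C\,e^{-c\,nD}.$$ -/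

import Mathlib

open MeasureTheory
open scoped Matrix ComplexOrder

noncomputable section

/-- Operators on the `n`-qubit Hilbert space `(ℂ²)^{⊗ n}`, as matrices in the computational basis,
whose elements are the bit strings `Fin n → Fin 2`. -/
abbrev QubitOp (n : ℕ) : Type := Matrix (Fin n → Fin 2) (Fin n → Fin 2) ℂ

/-- The `n`-qubit unitary group `U(2^n)`, with the subspace topology of the matrices. -/
abbrev QubitUnitary (n : ℕ) : Type := Matrix.unitaryGroup (Fin n → Fin 2) ℂ

instance (n : ℕ) : MeasurableSpace (QubitUnitary n) := borel _

instance (n : ℕ) : BorelSpace (QubitUnitary n) := ⟨rfl⟩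

instance (n : ℕ) : CompactSpace (QubitUnitary n) := by
  refine (isCompact_iff_compactSpace
    (s := (Matrix.unitaryGroup (Fin n → Fin 2) ℂ : Set (QubitOp n)))).mp ?_
  have hK : IsCompact (X := QubitOp n)
      (Set.univ.pi fun _ => Set.univ.pi fun _ => Metric.closedBall (0 : ℂ) 1) :=
    isCompact_univ_pi (X := fun _ : Fin n → Fin 2 => (Fin n → Fin 2) → ℂ)
      fun _ => isCompact_univ_pi fun _ => isCompact_closedBall (0 : ℂ) 1
  refine hK.of_isClosed_subset (isClosed_unitary (R := QubitOp n)) ?_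
  intro U hU i _ j _
  simpa using entry_norm_bound_of_unitary (𝕜 := ℂ) hU i j

/-- The Haar measure of the compact group `U(2^n)`, normalized to total mass one. -/
def haarUnitary (n : ℕ) : Measure (QubitUnitary n) := Measure.haarMeasure ⊤

/-- The law of `D` independent Haar-random `n`-qubit gates. -/
def randomGates (n D : ℕ) : Measure (Fin D → QubitUnitary n) :=
  Measure.pi fun _ => haarUnitary n

/-- Single-qubit density matrices: positive semidefinite with unit trace. -/
def IsQubitState (σ : Matrix (Fin 2) (Fin 2) ℂ) : Prop := σ.PosSemidef ∧ σ.trace = 1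

/-- The single-qubit replacement channel with rate `γ` and replacement state `σ`: the linear map
`Y ↦ (1 - γ) Y + γ Tr(Y) σ`, which takes a state `ρ` to `(1 - γ) ρ + γ σ`. -/
def replacementChannel (γ : ℝ) (σ : Matrix (Fin 2) (Fin 2) ℂ) :
    Matrix (Fin 2) (Fin 2) ℂ →ₗ[ℂ] Matrix (Fin 2) (Fin 2) ℂ :=
  (1 - (γ : ℂ)) • LinearMap.id +
    (γ : ℂ) • (Matrix.traceLinearMap (Fin 2) ℂ ℂ).smulRight σ

/-- The `n`-th tensor power `𝒩^{⊗ n}` of a linear map `𝒩` on single-qubit operators: the linear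
map with `|i⟩⟨j| ↦ ⨂ₖ 𝒩(|iₖ⟩⟨jₖ|)` for all bit strings `i` and `j`. -/
def tensorPow (n : ℕ) (N : Matrix (Fin 2) (Fin 2) ℂ →ₗ[ℂ] Matrix (Fin 2) (Fin 2) ℂ) :
    QubitOp n →ₗ[ℂ] QubitOp n where
  toFun X := Matrix.of fun a b =>
    ∑ i : Fin n → Fin 2, ∑ j : Fin n → Fin 2,
      X i j * ∏ k, N (Matrix.single (i k) (j k) 1) (a k) (b k)
  map_add' X Y := by
    ext a b
    simp [add_mul, Finset.sum_add_distrib]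
  map_smul' c X := by
    ext a b
    simp [mul_assoc, Finset.mul_sum]

/-- On product operators the tensor power acts factor by factor. -/
theorem tensorPow_product (n : ℕ)
    (N : Matrix (Fin 2) (Fin 2) ℂ →ₗ[ℂ] Matrix (Fin 2) (Fin 2) ℂ)
    (Y : Fin n → Matrix (Fin 2) (Fin 2) ℂ) :
    tensorPow n N (Matrix.of fun a b => ∏ k, Y k (a k) (b k)) =
      Matrix.of fun a b => ∏ k, N (Y k) (a k) (b k) := by
  ext a b
  have h : ∀ k, N (Y k) (a k) (b k) =
      ∑ i, ∑ j, Y k i j * N (Matrix.single i j 1) (a k) (b k) := by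
    intro k
    conv_lhs => rw [Matrix.matrix_eq_sum_single (Y k)]
    simp only [map_sum, Matrix.sum_apply]
    refine Finset.sum_congr rfl fun i _ => Finset.sum_congr rfl fun j _ => ?_
    have : Matrix.single i j (Y k i j) = Y k i j • Matrix.single i j (1 : ℂ) := by simp
    rw [this, map_smul, Matrix.smul_apply, smul_eq_mul]
  simp only [tensorPow, LinearMap.coe_mk, AddHom.coe_mk, Matrix.of_apply, h]
  rw [Finset.prod_univ_sum, Fintype.piFinset_univ]
  refine Finset.sum_congr rfl fun i _ => ?_
  rw [Finset.prod_univ_sum, Fintype.piFinset_univ]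
  exact Finset.sum_congr rfl fun j _ => Finset.prod_mul_distrib.symm

/-- Conjugation `X ↦ U X U†` by a global gate. -/
def gate {n : ℕ} (U : QubitUnitary n) : QubitOp n →ₗ[ℂ] QubitOp n where
  toFun X := (U : QubitOp n) * X * (U : QubitOp n)ᴴ
  map_add' X Y := by simp [mul_add, add_mul]
  map_smul' c X := by simp

/-- The noisy circuit `𝒩^{⊗ n} ∘ 𝒰_D ∘ ⋯ ∘ 𝒩^{⊗ n} ∘ 𝒰_1` of depth `D`. -/
def noisyCircuit {n : ℕ} (N : Matrix (Fin 2) (Fin 2) ℂ →ₗ[ℂ] Matrix (Fin 2) (Fin 2) ℂ) :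
    (D : ℕ) → (Fin D → QubitUnitary n) → QubitOp n →ₗ[ℂ] QubitOp n
  | 0, _ => LinearMap.id
  | D + 1, U => tensorPow n N ∘ₗ gate (U (Fin.last D)) ∘ₗ noisyCircuit N D fun k => U k.castSucc

/-- The trace norm `‖X‖₁ = Tr √(X† X)`. -/
def traceNorm {n : ℕ} (X : QubitOp n) : ℝ := (cfc Real.sqrt (Xᴴ * X)).trace.re

/-- The rank-one operator `|ψ⟩⟨ψ|`. -/
def pureState {n : ℕ} (ψ : EuclideanSpace ℂ (Fin n → Fin 2)) : QubitOp n :=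
  Matrix.of fun a b => ψ a * star (ψ b)

/-- The trace distance `½ ‖𝒞(|ψ⟩⟨ψ| - |φ⟩⟨φ|)‖₁` of the outputs of the depth-`D` circuit with gates
`U` and replacement noise, for the pure inputs `ψ` and `φ`. -/
def outputDistance {n D : ℕ} (γ : ℝ) (σ : Matrix (Fin 2) (Fin 2) ℂ)
    (ψ φ : EuclideanSpace ℂ (Fin n → Fin 2)) (U : Fin D → QubitUnitary n) : ℝ :=
  1 / 2 * traceNorm (noisyCircuit (replacementChannel γ σ) D U (pureState ψ - pureState φ))

end

/-! The argument follows the squared Hilbert–Schmidt norm. For a linear map T, the Haar average of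
Re⟨T(UXU†), T(UYU†)⟩ is a real bilinear form invariant under unitary conjugation, hence a multiple α
of the Hilbert–Schmidt form on traceless Hermitian matrices (`unitarily_invariant_form`). The factor
α is read off from the sum of the form over matrix units and its value at the identity, and both can
be computed without integrating.

For T = 𝒩^{⊗n} these two numbers are n-th powers of one-qubit quantities, and they give α ≤ (1 -
γ/2)^n (`integral_hsNormSq_layer_le`). The output of each layer is again traceless and Hermitian,
and the next gate is independent of it, so D layers contract by (1 - γ/2)^(nD)
(`integral_hsNormSq_noisyCircuit_le`). Passing to the trace norm costs a factor 2^(n/2)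
(`traceNorm_le_of_pos`). The exponent obtained is nD/2, slightly better than n(D - 1)/2, and C = 1
works. -/

noncomputable section

/-! ### Hilbert–Schmidt norm and its unitary invariance. -/

section HilbertSchmidt

variable {ι : Type*} [Fintype ι]

/-- The squared Hilbert--Schmidt norm of a matrix. -/
def hsNormSq (X : Matrix ι ι ℂ) : ℝ := ∑ a, ∑ b, Complex.normSq (X a b)

/-- The real part of the Hilbert--Schmidt inner product. -/
def hsInner (X Y : Matrix ι ι ℂ) : ℝ := ∑ a, ∑ b, (star (X a b) * Y a b).re

theorem hsInner_self (X : Matrix ι ι ℂ) : hsInner X X = hsNormSq X := by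
  simp [hsInner, hsNormSq, Complex.normSq_apply]

theorem hsInner_add_left (X Y Z : Matrix ι ι ℂ) :
    hsInner (X + Y) Z = hsInner X Z + hsInner Y Z := by
  simp only [hsInner, ← Finset.sum_add_distrib]
  refine Finset.sum_congr rfl fun _ _ => Finset.sum_congr rfl fun _ _ => ?_
  simp; ring

theorem hsInner_add_right (X Y Z : Matrix ι ι ℂ) :
    hsInner X (Y + Z) = hsInner X Y + hsInner X Z := by
  simp only [hsInner, ← Finset.sum_add_distrib]
  refine Finset.sum_congr rfl fun _ _ => Finset.sum_congr rfl fun _ _ => ?_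
  simp; ring

theorem hsInner_smul_left (r : ℝ) (X Y : Matrix ι ι ℂ) :
    hsInner (r • X) Y = r * hsInner X Y := by
  simp only [hsInner, Finset.mul_sum]
  refine Finset.sum_congr rfl fun _ _ => Finset.sum_congr rfl fun _ _ => ?_
  simp; ring

theorem hsInner_smul_right (r : ℝ) (X Y : Matrix ι ι ℂ) :
    hsInner X (r • Y) = r * hsInner X Y := by
  simp only [hsInner, Finset.mul_sum]
  refine Finset.sum_congr rfl fun _ _ => Finset.sum_congr rfl fun _ _ => ?_
  simp; ring

theorem hsInner_I_smul (X Y : Matrix ι ι ℂ) :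
    hsInner (Complex.I • X) (Complex.I • Y) = hsInner X Y := by
  simp only [hsInner]
  refine Finset.sum_congr rfl fun _ _ => Finset.sum_congr rfl fun _ _ => ?_
  simp

theorem hsNormSq_nonneg (X : Matrix ι ι ℂ) : 0 ≤ hsNormSq X :=
  Finset.sum_nonneg fun _ _ => Finset.sum_nonneg fun _ _ => Complex.normSq_nonneg _

theorem hsNormSq_eq_trace (X : Matrix ι ι ℂ) : hsNormSq X = (Xᴴ * X).trace.re := by
  simp only [hsNormSq, Matrix.trace, Matrix.diag, Matrix.mul_apply, Complex.re_sum]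
  rw [Finset.sum_comm]
  refine Finset.sum_congr rfl fun _ _ => Finset.sum_congr rfl fun _ _ => ?_
  simp [Complex.normSq_apply]

theorem hsNormSq_conj_unitary [DecidableEq ι] {V : Matrix ι ι ℂ}
    (hV : V ∈ Matrix.unitaryGroup ι ℂ) (X : Matrix ι ι ℂ) :
    hsNormSq (V * X * Vᴴ) = hsNormSq X := by
  have h : Vᴴ * V = 1 := Matrix.mem_unitaryGroup_iff'.mp hV
  rw [hsNormSq_eq_trace, hsNormSq_eq_trace]
  have : (V * X * Vᴴ)ᴴ * (V * X * Vᴴ) = V * (Xᴴ * X) * Vᴴ := by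
    simp only [Matrix.conjTranspose_mul, Matrix.conjTranspose_conjTranspose]
    calc V * (Xᴴ * Vᴴ) * (V * X * Vᴴ) = V * Xᴴ * (Vᴴ * V) * X * Vᴴ := by
          simp only [Matrix.mul_assoc]
      _ = _ := by rw [h]; simp only [Matrix.mul_assoc, Matrix.one_mul]
  rw [this, Matrix.trace_mul_comm, ← Matrix.mul_assoc, h, Matrix.one_mul]

theorem hsNormSq_diagonal [DecidableEq ι] (x : ι → ℝ) :
    hsNormSq (Matrix.diagonal fun i => (x i : ℂ)) = ∑ i, x i ^ 2 := by
  refine Finset.sum_congr rfl fun i _ => ?_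
  rw [Finset.sum_eq_single i]
  · simp [Complex.normSq_apply, sq]
  · intro j _ hj
    simp [Matrix.diagonal_apply_ne' _ hj]
  · simp

theorem continuous_hsNormSq : Continuous (hsNormSq : Matrix ι ι ℂ → ℝ) := by
  unfold hsNormSq
  refine continuous_finsetSum _ fun a _ => continuous_finsetSum _ fun b _ => ?_
  exact Complex.continuous_normSq.comp (by fun_prop)

end HilbertSchmidt

/-! ### Real bilinear forms invariant under unitary conjugation. -/

section InvariantForm

theorem exists_perm_map_pair {ι : Type*} [DecidableEq ι] {i j k l : ι} (hij : i ≠ j) (hkl : k ≠ l) :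
    ∃ π : Equiv.Perm ι, π i = k ∧ π j = l := by
  refine ⟨(Equiv.swap i k).trans (Equiv.swap (Equiv.swap i k j) l), ?_, by simp⟩
  have : k ≠ Equiv.swap i k j := fun h => by
    have := congrArg (Equiv.swap i k) h
    simp at this
    exact hij this
  simp [Equiv.swap_apply_of_ne_of_ne this hkl]

variable {ι : Type*} [Fintype ι] [DecidableEq ι]

theorem permMatrix_conj_single (π : Equiv.Perm ι) (i j : ι) (c : ℂ) :
    π.permMatrix ℂ * Matrix.single (π i) (π j) c * (π.permMatrix ℂ)ᴴ = Matrix.single i j c := by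
  rw [Matrix.conjTranspose_permMatrix, Equiv.Perm.permMatrix, Equiv.Perm.permMatrix,
    PEquiv.toMatrix_toPEquiv_mul, PEquiv.mul_toMatrix_toPEquiv]
  ext a b
  simp [Matrix.single_apply, ← Equiv.Perm.inv_def]

theorem permMatrix_mem_unitaryGroup (π : Equiv.Perm ι) :
    π.permMatrix ℂ ∈ Matrix.unitaryGroup ι ℂ := by
  rw [Matrix.mem_unitaryGroup_iff, Matrix.star_eq_conjTranspose, Matrix.conjTranspose_permMatrix,
    ← Matrix.permMatrix_mul]
  simp

variable {B : LinearMap.BilinForm ℝ (Matrix ι ι ℂ)}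

/-- Permutation matrices are unitary and permute the diagonal units two-transitively, so only
coincidence of the indices matters. -/
theorem exists_diagonal_values
    (hB : ∀ V ∈ Matrix.unitaryGroup ι ℂ, ∀ X Y, B (V * X * Vᴴ) (V * Y * Vᴴ) = B X Y) :
    ∃ α β : ℝ, ∀ i j, B (Matrix.single i i 1) (Matrix.single j j 1) = β + if i = j then α else 0 := by
  have hperm (π : Equiv.Perm ι) (i j : ι) :
      B (Matrix.single (π i) (π i) 1) (Matrix.single (π j) (π j) 1) =
        B (Matrix.single i i 1) (Matrix.single j j 1) := by
    rw [← hB _ (permMatrix_mem_unitaryGroup π), permMatrix_conj_single, permMatrix_conj_single]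
  obtain ⟨β, hβ⟩ : ∃ β, ∀ i j : ι, i ≠ j →
      B (Matrix.single i i 1) (Matrix.single j j 1) = β := by
    by_cases h : ∃ k l : ι, k ≠ l
    · obtain ⟨k, l, hkl⟩ := h
      refine ⟨B (Matrix.single k k 1) (Matrix.single l l 1), fun i j hij => ?_⟩
      obtain ⟨π, rfl, rfl⟩ := exists_perm_map_pair hij hkl
      exact (hperm π i j).symm
    · push Not at h
      exact ⟨0, fun i j hij => absurd (h i j) hij⟩
  obtain ⟨α, hα⟩ : ∃ α, ∀ i : ι, B (Matrix.single i i 1) (Matrix.single i i 1) = α := by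
    by_cases h : Nonempty ι
    · obtain ⟨k⟩ := h
      refine ⟨B (Matrix.single k k 1) (Matrix.single k k 1), fun i => ?_⟩
      have := hperm (Equiv.swap i k) i i
      simpa using this.symm
    · exact ⟨0, fun i => absurd ⟨i⟩ h⟩
  refine ⟨α - β, β, fun i j => ?_⟩
  split_ifs with h
  · subst h
    rw [hα]; ring
  · rw [hβ i j h]; ring

theorem bilin_diagonal {α β : ℝ}
    (hd : ∀ i j, B (Matrix.single i i 1) (Matrix.single j j 1) = β + if i = j then α else 0)
    (x : ι → ℝ) :
    B (Matrix.diagonal fun i => (x i : ℂ)) (Matrix.diagonal fun i => (x i : ℂ)) =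
      β * (∑ i, x i) ^ 2 + α * ∑ i, x i ^ 2 := by
  have h : (Matrix.diagonal fun i => (x i : ℂ)) = ∑ i, x i • Matrix.single i i (1 : ℂ) := by
    rw [← Matrix.sum_single_eq_diagonal]
    exact Finset.sum_congr rfl fun i _ => by simp [Matrix.smul_single]
  rw [h]
  simp only [map_sum, LinearMap.sum_apply, map_smul, LinearMap.smul_apply, smul_eq_mul, hd]
  rw [sq, Finset.sum_mul_sum]
  simp only [mul_add, Finset.sum_add_distrib, Finset.mul_sum]
  congr 1
  · exact Finset.sum_congr rfl fun _ _ => Finset.sum_congr rfl fun _ _ => by ring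
  · refine Finset.sum_congr rfl fun i _ => ?_
    rw [Finset.sum_eq_single i]
    · simp; ring
    · intro j _ hj
      simp [hj]
    · simp

/-- Invariance reduces to the diagonal matrix of eigenvalues; their sum vanishes, which kills the β
term. -/
theorem bilin_hermitian_traceless {α β : ℝ}
    (hB : ∀ V ∈ Matrix.unitaryGroup ι ℂ, ∀ X Y, B (V * X * Vᴴ) (V * Y * Vᴴ) = B X Y)
    (hd : ∀ i j, B (Matrix.single i i 1) (Matrix.single j j 1) = β + if i = j then α else 0)
    {X : Matrix ι ι ℂ} (hX : X.IsHermitian) (ht : X.trace = 0) :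
    B X X = α * hsNormSq X := by
  have hs := hX.spectral_theorem
  rw [Unitary.conjStarAlgAut_apply, Matrix.star_eq_conjTranspose] at hs
  have h0 : ∑ i, hX.eigenvalues i = 0 := by
    have := hX.trace_eq_sum_eigenvalues
    rw [ht] at this
    exact RCLike.ofReal_eq_zero (K := ℂ).mp (by push_cast; exact this.symm)
  have hV := hX.eigenvectorUnitary.2
  rw [hs, hB _ hV, hsNormSq_conj_unitary hV]
  have := bilin_diagonal hd hX.eigenvalues
  rw [h0] at this
  have h2 := hsNormSq_diagonal hX.eigenvalues
  simp only [Function.comp_def, RCLike.ofReal_eq_complex_ofReal] at *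
  rw [h2, this]; ring

/-- Off-diagonal units are not Hermitian, but E_ij + E_ji and i(E_ij - E_ji) are Hermitian and
traceless. Adding the values of the form on these two cancels the cross terms. Since the form is
only real bilinear, `hI` is what removes the factor i. -/
theorem sum_bilin_single {α β : ℝ}
    (hB : ∀ V ∈ Matrix.unitaryGroup ι ℂ, ∀ X Y, B (V * X * Vᴴ) (V * Y * Vᴴ) = B X Y)
    (hI : ∀ X, B (Complex.I • X) (Complex.I • X) = B X X)
    (hd : ∀ i j, B (Matrix.single i i 1) (Matrix.single j j 1) = β + if i = j then α else 0) :
    ∑ i, ∑ j, B (Matrix.single i j 1) (Matrix.single i j 1) =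
      (Fintype.card ι : ℝ) ^ 2 * α + Fintype.card ι * β := by
  have hoff (i j : ι) : B (Matrix.single i j 1) (Matrix.single i j 1) +
      B (Matrix.single j i 1) (Matrix.single j i 1) = 2 * (α + if i = j then β else 0) := by
    split_ifs with hij
    · subst hij
      rw [hd, if_pos rfl]; ring
    · have hji : j ≠ i := fun h => hij h.symm
      have hn (c : ℂ) : hsNormSq (c • (Matrix.single i j (1 : ℂ)) + star c • Matrix.single j i 1) =
          2 * Complex.normSq c := by
        rw [hsNormSq, Finset.sum_eq_add i j hij, Finset.sum_eq_single j, Finset.sum_eq_single i]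
        · simp [hij, hji]; ring
        · intro b _ hb
          simp [hij, hb.symm]
        · simp
        · intro b _ hb
          simp [hji, hb.symm]
        · simp
        · intro a _ ha
          exact Finset.sum_eq_zero fun b _ => by simp [ha.1.symm, ha.2.symm]
        · simp
        · simp
      have hq (c : ℂ) : B (c • (Matrix.single i j (1 : ℂ)) + star c • Matrix.single j i 1)
          (c • (Matrix.single i j (1 : ℂ)) + star c • Matrix.single j i 1) =
          α * (2 * Complex.normSq c) := by
        rw [← hn]
        refine bilin_hermitian_traceless hB hd ?_ ?_
        · simp [Matrix.IsHermitian, Matrix.conjTranspose_add,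
            Matrix.conjTranspose_single, add_comm]
        · simp [Matrix.trace_add, Matrix.trace_single_eq_of_ne _ _ _ hij,
            Matrix.trace_single_eq_of_ne _ _ _ hji]
      have h1 := hq 1
      have h2 := hq Complex.I
      have h3 : Complex.I • Matrix.single i j (1 : ℂ) + star Complex.I • Matrix.single j i (1 : ℂ) =
          Complex.I • (Matrix.single i j (1 : ℂ) - Matrix.single j i 1) := by
        rw [smul_sub, sub_eq_add_neg, Complex.star_def, Complex.conj_I, neg_smul]
      rw [h3, hI] at h2
      simp only [star_one, one_smul, map_one, Complex.normSq_I, map_add, map_sub,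
        LinearMap.add_apply, LinearMap.sub_apply] at h1 h2
      linarith
  have hs : 2 * ∑ i, ∑ j, B (Matrix.single i j 1) (Matrix.single i j 1) =
      ∑ i : ι, ∑ j : ι, 2 * (α + if i = j then β else 0) := by
    have hc : ∑ i : ι, ∑ j : ι, B (Matrix.single j i 1) (Matrix.single j i 1) =
        ∑ i, ∑ j, B (Matrix.single i j 1) (Matrix.single i j 1) := Finset.sum_comm
    simp only [← hoff, Finset.sum_add_distrib, hc]
    ring
  simp only [← Finset.mul_sum, Finset.sum_add_distrib, Finset.sum_const, Finset.sum_ite_eq,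
    Finset.mem_univ, if_true, Finset.card_univ, nsmul_eq_mul] at hs
  linarith

/-- A unitarily invariant form is proportional to the Hilbert--Schmidt form on traceless Hermitian
matrices, and the factor is read off from its trace. -/
theorem unitarily_invariant_form [Nonempty ι]
    (hB : ∀ V ∈ Matrix.unitaryGroup ι ℂ, ∀ X Y, B (V * X * Vᴴ) (V * Y * Vᴴ) = B X Y)
    (hI : ∀ X, B (Complex.I • X) (Complex.I • X) = B X X)
    {X : Matrix ι ι ℂ} (hX : X.IsHermitian) (ht : X.trace = 0) :
    ((Fintype.card ι : ℝ) ^ 2 - 1) * B X X =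
      (∑ i, ∑ j, B (Matrix.single i j 1) (Matrix.single i j 1) - B 1 1 / Fintype.card ι) *
        hsNormSq X := by
  obtain ⟨α, β, hd⟩ := exists_diagonal_values hB
  rw [bilin_hermitian_traceless hB hd hX ht, sum_bilin_single hB hI hd]
  -- With d the dimension, B(1,1) = βd² + αd, so subtracting B(1,1)/d from d²α + dβ eliminates β and
  -- leaves (d² - 1)α.
  have h1 := bilin_diagonal hd fun _ => 1
  simp only [Complex.ofReal_one, Matrix.diagonal_one, one_pow, Finset.sum_const, Finset.card_univ,
    nsmul_eq_mul, mul_one] at h1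
  rw [h1]
  have : (Fintype.card ι : ℝ) ≠ 0 := Nat.cast_ne_zero.mpr Fintype.card_ne_zero
  field_simp
  ring

end InvariantForm

/-! ### Haar averages over a single random gate. -/

section HaarAverage

variable {n : ℕ}

instance (n : ℕ) : SecondCountableTopology (QubitOp n) :=
  inferInstanceAs (SecondCountableTopology ((Fin n → Fin 2) → (Fin n → Fin 2) → ℂ))

instance (n : ℕ) : SecondCountableTopology (QubitUnitary n) :=
  TopologicalSpace.Subtype.secondCountableTopology
    (Matrix.unitaryGroup (Fin n → Fin 2) ℂ : Set (QubitOp n))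

instance (n : ℕ) : IsProbabilityMeasure (haarUnitary n) :=
  ⟨by simpa [haarUnitary] using Measure.haarMeasure_self (G := QubitUnitary n) (K₀ := ⊤)⟩

instance (n : ℕ) : (haarUnitary n).IsHaarMeasure :=
  inferInstanceAs (Measure.haarMeasure _).IsHaarMeasure

instance (n D : ℕ) : IsProbabilityMeasure (randomGates n D) :=
  inferInstanceAs (IsProbabilityMeasure (Measure.pi _))

instance (n : ℕ) : (haarUnitary n).IsMulRightInvariant where
  map_mul_right_eq_self g := by
    have : IsProbabilityMeasure (Measure.map (· * g) (haarUnitary n)) :=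
      Measure.isProbabilityMeasure_map (by fun_prop)
    -- A right translate is again left invariant of mass one, so uniqueness of Haar measure applies.
    exact Measure.isHaarMeasure_eq_of_isProbabilityMeasure _ _

theorem gate_apply (U : QubitUnitary n) (X : QubitOp n) :
    gate U X = (U : QubitOp n) * X * (U : QubitOp n)ᴴ := rfl

theorem gate_mul (U V : QubitUnitary n) (X : QubitOp n) : gate (U * V) X = gate U (gate V X) := by
  simp [gate_apply, Matrix.mul_assoc]

theorem continuous_gate_left (X : QubitOp n) :
    Continuous fun U : QubitUnitary n => gate U X := by
  simp only [gate_apply]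
  fun_prop

theorem continuous_linearMap_apply (T : QubitOp n →ₗ[ℂ] QubitOp n) : Continuous T :=
  T.continuous_of_finiteDimensional

theorem Continuous.integrable_of_compactSpace {X : Type*} [TopologicalSpace X] [CompactSpace X]
    [MeasurableSpace X] [OpensMeasurableSpace X] {μ : Measure X} [IsFiniteMeasure μ] {f : X → ℝ}
    (hf : Continuous f) : Integrable f μ :=
  hf.integrable_of_hasCompactSupport (HasCompactSupport.of_compactSpace f)

theorem continuous_hsInner_gate (T : QubitOp n →ₗ[ℂ] QubitOp n) (X Y : QubitOp n) :
    Continuous fun U : QubitUnitary n => hsInner (T (gate U X)) (T (gate U Y)) := by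
  have h (Z : QubitOp n) : Continuous fun U : QubitUnitary n => T (gate U Z) :=
    Continuous.comp (g := T) (f := fun U : QubitUnitary n => gate U Z)
      (continuous_linearMap_apply T) (continuous_gate_left Z)
  unfold hsInner
  refine continuous_finsetSum _ fun a _ => continuous_finsetSum _ fun b _ => ?_
  exact Complex.continuous_re.comp
    (((h X).matrix_elem a b).star.mul ((h Y).matrix_elem a b))

theorem map_ofReal_smul (T : QubitOp n →ₗ[ℂ] QubitOp n) (r : ℝ) (X : QubitOp n) :
    T (r • X) = r • T X := by
  rw [← Complex.coe_smul, map_smul, Complex.coe_smul]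

/-- The Haar average of the Hilbert--Schmidt inner product of `T (U X U†)` and `T (U Y U†)`. -/
def twirledForm (T : QubitOp n →ₗ[ℂ] QubitOp n) : LinearMap.BilinForm ℝ (QubitOp n) :=
  LinearMap.mk₂ ℝ (fun X Y => ∫ U, hsInner (T (gate U X)) (T (gate U Y)) ∂(haarUnitary n))
    (fun X Y Z => by
      simp only [map_add, hsInner_add_left]
      exact integral_add (continuous_hsInner_gate T X Z).integrable_of_compactSpace
        (continuous_hsInner_gate T Y Z).integrable_of_compactSpace)
    (fun r X Y => by
      simp only [map_ofReal_smul, hsInner_smul_left, integral_const_mul, smul_eq_mul])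
    (fun X Y Z => by
      simp only [map_add, hsInner_add_right]
      exact integral_add (continuous_hsInner_gate T X Y).integrable_of_compactSpace
        (continuous_hsInner_gate T X Z).integrable_of_compactSpace)
    (fun r X Y => by
      simp only [map_ofReal_smul, hsInner_smul_right, integral_const_mul, smul_eq_mul])

theorem twirledForm_apply (T : QubitOp n →ₗ[ℂ] QubitOp n) (X Y : QubitOp n) :
    twirledForm T X Y = ∫ U, hsInner (T (gate U X)) (T (gate U Y)) ∂(haarUnitary n) := rfl

theorem twirledForm_self (T : QubitOp n →ₗ[ℂ] QubitOp n) (X : QubitOp n) :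
    twirledForm T X X = ∫ U, hsNormSq (T (gate U X)) ∂(haarUnitary n) := by
  simp only [twirledForm_apply, hsInner_self]

/-- Conjugating both arguments by V replaces U by UV, which right invariance absorbs. -/
theorem twirledForm_conj (T : QubitOp n →ₗ[ℂ] QubitOp n) {V : QubitOp n}
    (hV : V ∈ Matrix.unitaryGroup (Fin n → Fin 2) ℂ) (X Y : QubitOp n) :
    twirledForm T (V * X * Vᴴ) (V * Y * Vᴴ) = twirledForm T X Y := by
  have h := integral_mul_right_eq_self (μ := haarUnitary n)
    (fun U => hsInner (T (gate U X)) (T (gate U Y))) (⟨V, hV⟩ : QubitUnitary n)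
  simp only [gate_mul] at h
  exact h

theorem twirledForm_I_smul (T : QubitOp n →ₗ[ℂ] QubitOp n) (X : QubitOp n) :
    twirledForm T (Complex.I • X) (Complex.I • X) = twirledForm T X X := by
  simp only [twirledForm_apply, map_smul, hsInner_I_smul]

/-- If L is the coefficient matrix of l, the numbers l(U E_ij U†) are the entries of L conjugated by
the unitary Uᵀ. Applied to each entry of T, this makes the sum over matrix units independent of the
gate. -/
theorem sum_normSq_functional_gate (l : QubitOp n →ₗ[ℂ] ℂ) (U : QubitUnitary n) :
    ∑ i, ∑ j, Complex.normSq (l (gate U (Matrix.single i j 1))) =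
      ∑ i, ∑ j, Complex.normSq (l (Matrix.single i j 1)) := by
  set L : QubitOp n := Matrix.of fun i j => l (Matrix.single i j 1) with hL
  have hV : (U : QubitOp n)ᵀ ∈ Matrix.unitaryGroup (Fin n → Fin 2) ℂ := by
    have h := Matrix.mem_unitaryGroup_iff'.mp U.2
    rw [Matrix.mem_unitaryGroup_iff]
    have h' := congrArg Matrix.transpose h
    rwa [Matrix.transpose_mul, Matrix.transpose_one] at h'
  have h (i j : Fin n → Fin 2) : l (gate U (Matrix.single i j 1)) =
      ((U : QubitOp n)ᵀ * L * ((U : QubitOp n)ᵀ)ᴴ) i j := by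
    rw [Matrix.matrix_eq_sum_single (gate U (Matrix.single i j 1))]
    have hs (a b : Fin n → Fin 2) (c : ℂ) : l (Matrix.single a b c) = c * L a b := by
      rw [← mul_one c, ← smul_eq_mul, ← Matrix.smul_single, map_smul]
      simp [hL]
    simp only [map_sum, hs]
    simp only [Matrix.mul_apply, Finset.sum_mul]
    rw [Finset.sum_comm]
    refine Finset.sum_congr rfl fun b _ => Finset.sum_congr rfl fun a _ => ?_
    have : gate U (Matrix.single i j 1) a b = (U : QubitOp n) a i * star ((U : QubitOp n) b j) := by
      rw [gate_apply, Matrix.mul_apply, Finset.sum_eq_single j, Matrix.mul_apply,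
        Finset.sum_eq_single i]
      · simp
      · intro k _ hk; simp [hk.symm]
      · simp
      · intro k _ hk
        simp [Matrix.mul_apply, hk.symm]
      · simp
    rw [this]
    simp
    ring
  simp only [h]
  exact hsNormSq_conj_unitary hV L

theorem sum_sum_comm_sum_sum {κ : Type*} [Fintype κ] (f : κ → κ → κ → κ → ℝ) :
    ∑ i : κ, ∑ j : κ, ∑ a : κ, ∑ b : κ, f i j a b =
      ∑ a : κ, ∑ b : κ, ∑ i : κ, ∑ j : κ, f i j a b := by
  calc _ = ∑ i : κ, ∑ a : κ, ∑ j : κ, ∑ b : κ, f i j a b :=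
        Finset.sum_congr rfl fun _ _ => Finset.sum_comm
    _ = ∑ a : κ, ∑ i : κ, ∑ b : κ, ∑ j : κ, f i j a b := by
        rw [Finset.sum_comm]
        exact Finset.sum_congr rfl fun _ _ => Finset.sum_congr rfl fun _ _ => Finset.sum_comm
    _ = _ := Finset.sum_congr rfl fun _ _ => Finset.sum_comm

theorem sum_hsNormSq_gate (T : QubitOp n →ₗ[ℂ] QubitOp n) (U : QubitUnitary n) :
    ∑ i, ∑ j, hsNormSq (T (gate U (Matrix.single i j 1))) =
      ∑ i, ∑ j, hsNormSq (T (Matrix.single i j 1)) := by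
  have h (a b : Fin n → Fin 2) := sum_normSq_functional_gate (Matrix.entryLinearMap ℂ ℂ a b ∘ₗ T) U
  simp only [LinearMap.comp_apply, Matrix.entryLinearMap_apply] at h
  unfold hsNormSq
  rw [sum_sum_comm_sum_sum fun i j a b => Complex.normSq (T (gate U (Matrix.single i j 1)) a b),
    sum_sum_comm_sum_sum fun i j a b => Complex.normSq (T (Matrix.single i j 1) a b)]
  exact Finset.sum_congr rfl fun a _ => Finset.sum_congr rfl fun b _ => h a b

/-- Averaged over a Haar-random gate, a linear map scales the squared Hilbert--Schmidt norm of a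
traceless Hermitian operator by a fixed factor. -/
theorem integral_hsNormSq_gate (T : QubitOp n →ₗ[ℂ] QubitOp n) {X : QubitOp n}
    (hX : X.IsHermitian) (ht : X.trace = 0) :
    ((4 : ℝ) ^ n - 1) * ∫ U, hsNormSq (T (gate U X)) ∂(haarUnitary n) =
      (∑ i, ∑ j, hsNormSq (T (Matrix.single i j 1)) - hsNormSq (T 1) / 2 ^ n) * hsNormSq X := by
  have h := unitarily_invariant_form (B := twirledForm T)
    (fun V hV X Y => twirledForm_conj T hV X Y) (twirledForm_I_smul T) hX ht
  have hint (X : QubitOp n) : Integrable (fun U => hsNormSq (T (gate U X))) (haarUnitary n) := by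
    simpa only [hsInner_self] using (continuous_hsInner_gate T X X).integrable_of_compactSpace
  have hone : ∫ U, hsNormSq (T (gate U 1)) ∂(haarUnitary n) = hsNormSq (T 1) := by
    have (U : QubitUnitary n) : gate U 1 = 1 := by
      rw [gate_apply, Matrix.mul_one]
      exact Matrix.mem_unitaryGroup_iff.mp U.2
    simp [this]
  have hsum : ∑ i, ∑ j, ∫ U, hsNormSq (T (gate U (Matrix.single i j 1))) ∂(haarUnitary n) =
      ∑ i, ∑ j, hsNormSq (T (Matrix.single i j 1)) := by
    have (i : Fin n → Fin 2) :
        ∑ j, ∫ U, hsNormSq (T (gate U (Matrix.single i j 1))) ∂(haarUnitary n) =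
          ∫ U, ∑ j, hsNormSq (T (gate U (Matrix.single i j 1))) ∂(haarUnitary n) :=
      (integral_finsetSum _ fun j _ => hint _).symm
    simp only [this]
    rw [← integral_finsetSum _ fun i _ => integrable_finsetSum _ fun j _ => hint _]
    simp [sum_hsNormSq_gate]
  have hcard : (Fintype.card (Fin n → Fin 2) : ℝ) = 2 ^ n := by simp
  simp only [twirledForm_self, hcard] at h
  rw [hone, hsum] at h
  rw [← h, ← pow_mul, mul_comm n, pow_mul]
  norm_num

end HaarAverage

/-! ### Tensor powers of the replacement channel and the contraction of one layer. -/

section Channel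

theorem sum_pi_prod {R κ : Type*} [CommSemiring R] [Fintype κ] {n : ℕ} (f : Fin n → κ → R) :
    ∑ p : Fin n → κ, ∏ k, f k (p k) = ∏ k, ∑ x, f k x := by
  classical
  rw [Finset.prod_univ_sum, Fintype.piFinset_univ]

theorem sum_sum_pi_prod {R κ : Type*} [CommSemiring R] [Fintype κ] {n : ℕ}
    (f : Fin n → κ → κ → R) :
    ∑ p : Fin n → κ, ∑ q : Fin n → κ, ∏ k, f k (p k) (q k) = ∏ k, ∑ x, ∑ y, f k x y := by
  rw [← sum_pi_prod]
  exact Finset.sum_congr rfl fun p _ => sum_pi_prod fun k => f k (p k)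

variable {N : Matrix (Fin 2) (Fin 2) ℂ →ₗ[ℂ] Matrix (Fin 2) (Fin 2) ℂ}

theorem tensorPow_apply (n : ℕ) (X : QubitOp n) (a b : Fin n → Fin 2) :
    tensorPow n N X a b = ∑ i : Fin n → Fin 2, ∑ j : Fin n → Fin 2,
      X i j * ∏ k, N (Matrix.single (i k) (j k) 1) (a k) (b k) := rfl

theorem tensorPow_single (n : ℕ) (i j a b : Fin n → Fin 2) :
    tensorPow n N (Matrix.single i j 1) a b =
      ∏ k, N (Matrix.single (i k) (j k) 1) (a k) (b k) := by
  rw [tensorPow_apply, Finset.sum_eq_single i, Finset.sum_eq_single j]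
  · simp
  · intro c _ hc; simp [hc.symm]
  · simp
  · intro c _ hc; simp [hc.symm]
  · simp

theorem sum_hsNormSq_tensorPow (n : ℕ) :
    ∑ i, ∑ j, hsNormSq (tensorPow n N (Matrix.single i j 1)) =
      (∑ i, ∑ j, hsNormSq (N (Matrix.single i j 1))) ^ n := by
  simp only [hsNormSq, tensorPow_single, map_prod]
  have h (i j : Fin n → Fin 2) := sum_sum_pi_prod fun k x y =>
    Complex.normSq (N (Matrix.single (i k) (j k) 1) x y)
  simp only [h]
  rw [sum_sum_pi_prod fun k i j => ∑ x, ∑ y, Complex.normSq (N (Matrix.single i j 1) x y)]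
  simp

theorem hsNormSq_tensorPow_one (n : ℕ) :
    hsNormSq (tensorPow n N 1) = hsNormSq (N 1) ^ n := by
  have h : (1 : QubitOp n) =
      Matrix.of fun a b => ∏ k, (1 : Matrix (Fin 2) (Fin 2) ℂ) (a k) (b k) := by
    ext a b
    simp [Matrix.one_apply, Finset.prod_ite_zero, funext_iff]
  rw [h, tensorPow_product]
  simp only [hsNormSq, Matrix.of_apply, map_prod]
  rw [sum_sum_pi_prod fun k x y => Complex.normSq (N 1 x y)]
  simp

theorem trace_tensorPow (hN : ∀ Y, (N Y).trace = Y.trace) (n : ℕ) (X : QubitOp n) :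
    (tensorPow n N X).trace = X.trace := by
  have h (i j : Fin n → Fin 2) :
      ∑ a : Fin n → Fin 2, ∏ k, N (Matrix.single (i k) (j k) 1) (a k) (a k) =
        if i = j then 1 else 0 := by
    rw [sum_pi_prod fun k x => N (Matrix.single (i k) (j k) 1) x x]
    have (k : Fin n) : ∑ x, N (Matrix.single (i k) (j k) 1) x x = if i k = j k then 1 else 0 := by
      have := hN (Matrix.single (i k) (j k) 1)
      refine this.trans ?_
      split_ifs with h
      · rw [h, Matrix.trace_single_eq_same]
      · exact Matrix.trace_single_eq_of_ne _ _ _ h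
    simp [this, Finset.prod_ite_zero, funext_iff]
  simp only [Matrix.trace, Matrix.diag, tensorPow_apply]
  rw [Finset.sum_comm]
  refine Finset.sum_congr rfl fun i _ => ?_
  rw [Finset.sum_comm]
  simp only [← Finset.mul_sum, h]
  simp

theorem isHermitian_tensorPow (hN : ∀ Y, N Yᴴ = (N Y)ᴴ) {n : ℕ} {X : QubitOp n}
    (hX : X.IsHermitian) : (tensorPow n N X).IsHermitian := by
  ext a b
  rw [Matrix.conjTranspose_apply, tensorPow_apply, tensorPow_apply, Finset.sum_comm]
  simp only [star_sum]
  refine Finset.sum_congr rfl fun i _ => Finset.sum_congr rfl fun j _ => ?_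
  rw [star_mul', hX.apply, star_prod]
  congr 1
  refine Finset.prod_congr rfl fun k _ => ?_
  rw [← Matrix.conjTranspose_apply, ← hN, Matrix.conjTranspose_single, star_one]

variable {γ : ℝ} {σ : Matrix (Fin 2) (Fin 2) ℂ}

theorem replacementChannel_apply (Y : Matrix (Fin 2) (Fin 2) ℂ) :
    replacementChannel γ σ Y = (1 - (γ : ℂ)) • Y + (γ : ℂ) • Y.trace • σ := by
  simp [replacementChannel]

theorem trace_replacementChannel (hσ : IsQubitState σ) (Y : Matrix (Fin 2) (Fin 2) ℂ) :
    (replacementChannel γ σ Y).trace = Y.trace := by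
  simp [replacementChannel_apply, Matrix.trace_add, Matrix.trace_smul, hσ.2]
  ring

theorem replacementChannel_conjTranspose (hσ : IsQubitState σ) (Y : Matrix (Fin 2) (Fin 2) ℂ) :
    replacementChannel γ σ Yᴴ = (replacementChannel γ σ Y)ᴴ := by
  have h : σᴴ = σ := hσ.1.1
  simp [replacementChannel_apply, Matrix.conjTranspose_add, Matrix.conjTranspose_smul, h,
    Matrix.trace_conjTranspose, smul_smul]

/-- In dimension two, Tr σ² = (Tr σ)² - 2 det σ, and det σ ≥ 0. -/
theorem IsQubitState.hsNormSq_le_one (hσ : IsQubitState σ) : hsNormSq σ ≤ 1 := by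
  have h0 := Complex.nonneg_iff.mp (hσ.1.diag_nonneg (i := 0))
  have h1 := Complex.nonneg_iff.mp (hσ.1.diag_nonneg (i := 1))
  have hd := (Complex.nonneg_iff.mp hσ.1.det_nonneg).1
  have hc : σ 1 0 = star (σ 0 1) := (hσ.1.1.apply 1 0).symm
  have ht : (σ 0 0).re + (σ 1 1).re = 1 := by
    have := congrArg Complex.re hσ.2
    rwa [Matrix.trace_fin_two] at this
  rw [Matrix.det_fin_two, hc] at hd
  simp only [hsNormSq, Fin.sum_univ_two, Complex.normSq_apply, hc]
  simp [← h0.2, ← h1.2] at hd ⊢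
  nlinarith [congrArg (· ^ 2) ht]

/-- The image of the identity has trace 2; Cauchy–Schwarz on its two diagonal entries suffices. -/
theorem two_le_hsNormSq_replacementChannel_one (hσ : IsQubitState σ) :
    2 ≤ hsNormSq (replacementChannel γ σ 1) := by
  have h := trace_replacementChannel (γ := γ) hσ 1
  set Z := replacementChannel γ σ 1
  rw [Matrix.trace_fin_two, Matrix.trace_one] at h
  have h' := congrArg Complex.re h
  simp at h'
  simp only [hsNormSq, Fin.sum_univ_two, Complex.normSq_apply]
  nlinarith [sq_nonneg ((Z 0 0).re - (Z 1 1).re), sq_nonneg (Z 0 0).im, sq_nonneg (Z 1 1).im,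
    sq_nonneg (Z 0 1).im, sq_nonneg (Z 0 1).re, sq_nonneg (Z 1 0).im, sq_nonneg (Z 1 0).re]

theorem sum_hsNormSq_replacementChannel_le (hσ : IsQubitState σ) (h0 : 0 ≤ γ) (h1 : γ ≤ 1) :
    ∑ i, ∑ j, hsNormSq (replacementChannel γ σ (Matrix.single i j 1)) ≤ 4 - 2 * γ := by
  have hs := hσ.hsNormSq_le_one
  have ht : (σ 0 0).re + (σ 1 1).re = 1 := by
    have := congrArg Complex.re hσ.2
    rwa [Matrix.trace_fin_two] at this
  have key : ∑ i, ∑ j, hsNormSq (replacementChannel γ σ (Matrix.single i j 1)) =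
      4 * (1 - γ) ^ 2 + 2 * γ * (1 - γ) * ((σ 0 0).re + (σ 1 1).re) + 2 * γ ^ 2 * hsNormSq σ := by
    simp [hsNormSq, Fin.sum_univ_two, Complex.normSq_apply, replacementChannel_apply]
    ring
  rw [key, ht]
  -- With purity at most 1 the sum is at most 4 - 6γ + 4γ², which is 4 - 2γ minus 4γ(1 - γ).
  nlinarith [mul_nonneg h0 (sub_nonneg.mpr h1), sq_nonneg γ]

theorem integral_hsNormSq_layer_le (hσ : IsQubitState σ) (h0 : 0 ≤ γ) (h1 : γ ≤ 1) {n : ℕ}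
    (hn : n ≠ 0) {X : QubitOp n} (hX : X.IsHermitian) (ht : X.trace = 0) :
    ∫ U, hsNormSq (tensorPow n (replacementChannel γ σ) (gate U X)) ∂(haarUnitary n) ≤
      (1 - γ / 2) ^ n * hsNormSq X := by
  have h := integral_hsNormSq_gate (tensorPow n (replacementChannel γ σ)) hX ht
  rw [sum_hsNormSq_tensorPow, hsNormSq_tensorPow_one, ← div_pow] at h
  have h4 : (0 : ℝ) < 4 ^ n - 1 := sub_pos.mpr (one_lt_pow₀ (by norm_num) hn)
  have ha : (∑ i, ∑ j, hsNormSq (replacementChannel γ σ (Matrix.single i j 1))) ^ n ≤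
      4 ^ n * (1 - γ / 2) ^ n := by
    rw [← mul_pow]
    refine pow_le_pow_left₀ (Finset.sum_nonneg fun _ _ => Finset.sum_nonneg fun _ _ =>
      hsNormSq_nonneg _) ?_ n
    linarith [sum_hsNormSq_replacementChannel_le hσ h0 h1]
  have hb : 1 ≤ (hsNormSq (replacementChannel γ σ 1) / 2) ^ n :=
    one_le_pow₀ (by linarith [two_le_hsNormSq_replacementChannel_one (γ := γ) hσ])
  have hc : (1 - γ / 2) ^ n ≤ 1 := pow_le_one₀ (by linarith) (by linarith)
  refine le_of_mul_le_mul_left ?_ h4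
  rw [h, ← mul_assoc]
  -- With q = 1 - γ/2, the identity term contributes at least 1, and 4^n q^n - 1 ≤ (4^n - 1) q^n
  -- because q^n ≤ 1.
  exact mul_le_mul_of_nonneg_right (by linarith) (hsNormSq_nonneg X)

end Channel

/-! ### Trace norm: continuity and comparison with the Hilbert–Schmidt norm. -/

section TraceNorm

variable {n : ℕ}

theorem conjTranspose_mul_self_isSelfAdjoint (X : QubitOp n) : IsSelfAdjoint (Xᴴ * X) :=
  Matrix.isHermitian_conjTranspose_mul_self X

open scoped Matrix.Norms.L2Operator in
theorem continuous_traceNorm : Continuous (traceNorm : QubitOp n → ℝ) := by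
  have h : Continuous fun X : QubitOp n => cfc Real.sqrt (Xᴴ * X) := by
    refine Continuous.cfc_of_mem_nhdsSet (s := Set.univ) Real.sqrt Filter.univ_mem ?_
      conjTranspose_mul_self_isSelfAdjoint Real.continuous_sqrt.continuousOn
    fun_prop
  exact Complex.continuous_re.comp (Continuous.matrix_trace h)

/-- AM–GM, √λ ≤ (t + λ/t)/2, summed over the 2^n eigenvalues of X†X. Being affine in the squared
norm, the bound can be averaged directly, without Jensen's inequality. -/
theorem traceNorm_le_of_pos (X : QubitOp n) {t : ℝ} (ht : 0 < t) :
    traceNorm X ≤ (t * 2 ^ n + hsNormSq X / t) / 2 := by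
  have hA : (Xᴴ * X).IsHermitian := Matrix.isHermitian_conjTranspose_mul_self X
  have hpos := (Matrix.posSemidef_conjTranspose_mul_self X).eigenvalues_nonneg
  have h1 : traceNorm X = ∑ i, √(hA.eigenvalues i) := by
    rw [traceNorm, hA.cfc_eq, Matrix.IsHermitian.cfc, Unitary.conjStarAlgAut_apply,
      Matrix.trace_mul_comm, ← Matrix.mul_assoc, Unitary.coe_star_mul_self, Matrix.one_mul,
      Matrix.trace_diagonal]
    simp
  have h2 : hsNormSq X = ∑ i, hA.eigenvalues i := by
    rw [hsNormSq_eq_trace, hA.trace_eq_sum_eigenvalues]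
    simp
  have h3 : (t * 2 ^ n + hsNormSq X / t) / 2 = ∑ i, (t + hA.eigenvalues i / t) / 2 := by
    rw [h2, ← Finset.sum_div, Finset.sum_add_distrib, Finset.sum_div]
    simp
    ring
  rw [h1, h3]
  refine Finset.sum_le_sum fun i _ => ?_
  have hs := Real.sq_sqrt (hpos i)
  have h4 : t + √(hA.eigenvalues i) ^ 2 / t - √(hA.eigenvalues i) * 2 =
      (t - √(hA.eigenvalues i)) ^ 2 / t := by
    field_simp
    ring
  have h5 : 0 ≤ (t - √(hA.eigenvalues i)) ^ 2 / t := by positivity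
  rw [hs] at h4
  rw [le_div_iff₀ two_pos]
  linarith

end TraceNorm

/-! ### Contraction through all D layers. -/

section Circuit

variable {n : ℕ} {N : Matrix (Fin 2) (Fin 2) ℂ →ₗ[ℂ] Matrix (Fin 2) (Fin 2) ℂ}

theorem trace_gate (U : QubitUnitary n) (X : QubitOp n) : (gate U X).trace = X.trace := by
  have h : (U : QubitOp n)ᴴ * (U : QubitOp n) = 1 := Matrix.mem_unitaryGroup_iff'.mp U.2
  rw [gate_apply, Matrix.trace_mul_comm, ← Matrix.mul_assoc, h, Matrix.one_mul]

theorem isHermitian_gate (U : QubitUnitary n) {X : QubitOp n} (hX : X.IsHermitian) :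
    (gate U X).IsHermitian :=
  Matrix.isHermitian_mul_mul_conjTranspose _ hX

theorem noisyCircuit_succ (D : ℕ) (U : Fin (D + 1) → QubitUnitary n) (X : QubitOp n) :
    noisyCircuit N (D + 1) U X =
      tensorPow n N (gate (U (Fin.last D)) (noisyCircuit N D (fun k => U k.castSucc) X)) := rfl

theorem trace_noisyCircuit (hN : ∀ Y, (N Y).trace = Y.trace) (D : ℕ)
    (U : Fin D → QubitUnitary n) (X : QubitOp n) : (noisyCircuit N D U X).trace = X.trace := by
  induction D with
  | zero => rfl
  | succ D ih => rw [noisyCircuit_succ, trace_tensorPow hN, trace_gate, ih]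

theorem isHermitian_noisyCircuit (hN : ∀ Y, N Yᴴ = (N Y)ᴴ) (D : ℕ)
    (U : Fin D → QubitUnitary n) {X : QubitOp n} (hX : X.IsHermitian) :
    (noisyCircuit N D U X).IsHermitian := by
  induction D with
  | zero => exact hX
  | succ D ih =>
    rw [noisyCircuit_succ]
    exact isHermitian_tensorPow hN (isHermitian_gate _ (ih _))

theorem continuous_noisyCircuit (D : ℕ) (X : QubitOp n) :
    Continuous fun U : Fin D → QubitUnitary n => noisyCircuit N D U X := by
  induction D with
  | zero => exact continuous_const
  | succ D ih =>
    simp only [noisyCircuit_succ, gate_apply]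
    refine Continuous.comp (g := tensorPow n N) (continuous_linearMap_apply _) ?_
    have h : Continuous fun U : Fin (D + 1) → QubitUnitary n =>
        noisyCircuit N D (fun k => U k.castSucc) X :=
      ih.comp (continuous_pi fun k => continuous_apply k.castSucc)
    fun_prop

theorem integral_hsNormSq_noisyCircuit_le {γ : ℝ} {σ : Matrix (Fin 2) (Fin 2) ℂ}
    (hσ : IsQubitState σ) (h0 : 0 ≤ γ) (h1 : γ ≤ 1) (hn : n ≠ 0) (D : ℕ) {X : QubitOp n}
    (hX : X.IsHermitian) (ht : X.trace = 0) :
    ∫ U, hsNormSq (noisyCircuit (replacementChannel γ σ) D U X) ∂(randomGates n D) ≤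
      (1 - γ / 2) ^ (n * D) * hsNormSq X := by
  induction D with
  | zero => simp [noisyCircuit]
  | succ D ih =>
    set N := replacementChannel γ σ
    -- The last gate is split off, so that it is averaged first with the earlier gates fixed.
    have hmp := measurePreserving_piFinSuccAbove (fun _ : Fin (D + 1) => haarUnitary n)
      (Fin.last D)
    have hint := hmp.integral_comp' (g := fun p : QubitUnitary n × (Fin D → QubitUnitary n) =>
      hsNormSq (tensorPow n N (gate p.1 (noisyCircuit N D p.2 X))))
    have hcont : Continuous fun p : QubitUnitary n × (Fin D → QubitUnitary n) =>
        hsNormSq (tensorPow n N (gate p.1 (noisyCircuit N D p.2 X))) := by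
      refine continuous_hsNormSq.comp
        (Continuous.comp (g := tensorPow n N) (continuous_linearMap_apply _) ?_)
      have h : Continuous fun p : QubitUnitary n × (Fin D → QubitUnitary n) =>
          noisyCircuit N D p.2 X := (continuous_noisyCircuit D X).comp continuous_snd
      simp only [gate_apply]
      fun_prop
    have hfub : ∫ U, hsNormSq (noisyCircuit N (D + 1) U X) ∂(randomGates n (D + 1)) =
        ∫ V, ∫ U, hsNormSq (tensorPow n N (gate U (noisyCircuit N D V X))) ∂(haarUnitary n)
          ∂(randomGates n D) := by
      rw [← integral_prod_symm _ hcont.integrable_of_compactSpace]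
      refine Eq.trans (integral_congr_ae (.of_forall fun U => ?_)) hint
      simp only [noisyCircuit_succ, MeasurableEquiv.piFinSuccAbove_apply,
        Fin.insertNthEquiv_symm_apply, Fin.removeNth_last]
      rfl
    rw [hfub]
    calc _ ≤ ∫ V, (1 - γ / 2) ^ n * hsNormSq (noisyCircuit N D V X) ∂(randomGates n D) := by
          refine integral_mono_of_nonneg (.of_forall fun V => integral_nonneg fun _ =>
            hsNormSq_nonneg _) ?_ (.of_forall fun V => ?_)
          · exact ((continuous_hsNormSq.comp
              (continuous_noisyCircuit D X)).integrable_of_compactSpace).const_mul _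
          · exact integral_hsNormSq_layer_le hσ h0 h1 hn
              (isHermitian_noisyCircuit (replacementChannel_conjTranspose hσ) D V hX)
              (by rw [trace_noisyCircuit (trace_replacementChannel hσ), ht])
      _ ≤ (1 - γ / 2) ^ n * ((1 - γ / 2) ^ (n * D) * hsNormSq X) := by
          rw [integral_const_mul]
          exact mul_le_mul_of_nonneg_left ih (pow_nonneg (by linarith) n)
      _ = _ := by ring

end Circuit

/-! ### Orthogonal pure inputs and the expected trace distance. -/

section OutputDistance

variable {n : ℕ}

theorem isHermitian_pureState (ψ : EuclideanSpace ℂ (Fin n → Fin 2)) :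
    (pureState ψ).IsHermitian := by
  ext a b
  simp [pureState, mul_comm]

theorem trace_pureState_mul (ψ φ : EuclideanSpace ℂ (Fin n → Fin 2)) :
    (pureState ψ * pureState φ).trace = inner ℂ ψ φ * inner ℂ φ ψ := by
  simp only [Matrix.trace, Matrix.diag, Matrix.mul_apply, pureState, Matrix.of_apply,
    PiLp.inner_apply, Finset.sum_mul_sum]
  rw [Finset.sum_comm]
  refine Finset.sum_congr rfl fun i _ => Finset.sum_congr rfl fun j _ => ?_
  simp
  ring

theorem trace_pureState (ψ : EuclideanSpace ℂ (Fin n → Fin 2)) :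
    (pureState ψ).trace = inner ℂ ψ ψ := by
  rw [PiLp.inner_apply]
  rfl

theorem trace_pureState_sub {ψ φ : EuclideanSpace ℂ (Fin n → Fin 2)} (hψ : ‖ψ‖ = 1)
    (hφ : ‖φ‖ = 1) : (pureState ψ - pureState φ).trace = 0 := by
  rw [Matrix.trace_sub, trace_pureState, trace_pureState, inner_self_eq_norm_sq_to_K,
    inner_self_eq_norm_sq_to_K, hψ, hφ, sub_self]

theorem hsNormSq_pureState_sub {ψ φ : EuclideanSpace ℂ (Fin n → Fin 2)} (hψ : ‖ψ‖ = 1)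
    (hφ : ‖φ‖ = 1) (h : inner ℂ ψ φ = 0) : hsNormSq (pureState ψ - pureState φ) = 2 := by
  have hψφ := trace_pureState_mul ψ φ
  have hφψ := trace_pureState_mul φ ψ
  have hψψ := trace_pureState_mul ψ ψ
  have hφφ := trace_pureState_mul φ φ
  rw [inner_self_eq_norm_sq_to_K, hψ] at hψψ
  rw [inner_self_eq_norm_sq_to_K, hφ] at hφφ
  rw [h, zero_mul] at hψφ
  rw [h, mul_zero] at hφψ
  rw [hsNormSq_eq_trace, ((isHermitian_pureState ψ).sub (isHermitian_pureState φ)).eq]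
  simp only [sub_mul, mul_sub, Matrix.trace_sub, hψφ, hφψ, hψψ, hφφ]
  norm_num

/-- For n = 0 the space is a line and has no orthogonal unit vectors. This excludes the case 4^n - 1
= 0 in the one-layer bound. -/
theorem ne_zero_of_orthonormal {ψ φ : EuclideanSpace ℂ (Fin n → Fin 2)} (hψ : ‖ψ‖ = 1)
    (hφ : ‖φ‖ = 1) (h : inner ℂ ψ φ = 0) : n ≠ 0 := by
  rintro rfl
  rw [PiLp.inner_apply, Fintype.sum_unique] at h
  rw [EuclideanSpace.norm_eq, Fintype.sum_unique] at hψ hφ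
  rcases mul_eq_zero.mp h with h | h <;> simp_all

variable {γ : ℝ} {σ : Matrix (Fin 2) (Fin 2) ℂ}

theorem continuous_outputDistance (D : ℕ) (ψ φ : EuclideanSpace ℂ (Fin n → Fin 2)) :
    Continuous fun U : Fin D → QubitUnitary n => outputDistance γ σ ψ φ U :=
  continuous_const.mul (continuous_traceNorm.comp (continuous_noisyCircuit D _))

theorem integral_outputDistance_le (hσ : IsQubitState σ) (h0 : 0 ≤ γ) (h1 : γ ≤ 1) (D : ℕ)
    {ψ φ : EuclideanSpace ℂ (Fin n → Fin 2)} (hψ : ‖ψ‖ = 1) (hφ : ‖φ‖ = 1)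
    (h : inner ℂ ψ φ = 0) :
    ∫ U, outputDistance γ σ ψ φ U ∂(randomGates n D) ≤
      (2 : ℝ) ^ ((n : ℝ) / 2) * (1 - γ / 2) ^ ((n : ℝ) * D / 2) := by
  have hq : 0 < 1 - γ / 2 := by linarith
  set X := pureState ψ - pureState φ with hX
  have hHS := integral_hsNormSq_noisyCircuit_le hσ h0 h1 (ne_zero_of_orthonormal hψ hφ h) D
    ((isHermitian_pureState ψ).sub (isHermitian_pureState φ)) (trace_pureState_sub hψ hφ)
  rw [hsNormSq_pureState_sub hψ hφ h, ← hX] at hHS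
  set a : ℝ := (2 : ℝ) ^ ((n : ℝ) / 2) with ha
  set b : ℝ := (1 - γ / 2) ^ ((n : ℝ) * D / 2) with hb
  have ha0 : 0 < a := Real.rpow_pos_of_pos two_pos _
  have hb0 : 0 < b := Real.rpow_pos_of_pos hq _
  have ha2 : a ^ 2 = 2 ^ n := by
    rw [ha, ← Real.rpow_natCast, ← Real.rpow_mul two_pos.le, ← Real.rpow_natCast]
    congr 1
    push_cast
    ring
  have hb2 : b ^ 2 = (1 - γ / 2) ^ (n * D) := by
    rw [hb, ← Real.rpow_natCast, ← Real.rpow_mul hq.le, ← Real.rpow_natCast]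
    congr 1
    push_cast
    ring
  rw [← hb2] at hHS
  have hint : Integrable (fun U : Fin D → QubitUnitary n =>
      hsNormSq (noisyCircuit (replacementChannel γ σ) D U X)) (randomGates n D) :=
    (continuous_hsNormSq.comp (continuous_noisyCircuit D X)).integrable_of_compactSpace
  -- The AM–GM parameter is t = b/a; the optimum √2·b/a would only improve the constant 3/4 below.
  have ht : 0 < b / a := div_pos hb0 ha0
  calc ∫ U, outputDistance γ σ ψ φ U ∂(randomGates n D)
      ≤ ∫ U, 1 / 2 * ((b / a * 2 ^ n +
          hsNormSq (noisyCircuit (replacementChannel γ σ) D U X) / (b / a)) / 2)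
            ∂(randomGates n D) := by
        refine integral_mono (continuous_outputDistance D ψ φ).integrable_of_compactSpace
          ((((integrable_const _).add (hint.div_const _)).div_const _).const_mul _) fun U => ?_
        exact mul_le_mul_of_nonneg_left (traceNorm_le_of_pos _ ht) (by norm_num)
    _ = 1 / 2 * ((b / a * a ^ 2 + (∫ U, hsNormSq (noisyCircuit (replacementChannel γ σ) D U X)
          ∂(randomGates n D)) / (b / a)) / 2) := by
        rw [integral_const_mul, integral_div, integral_add (integrable_const _)
          (hint.div_const _), integral_div, integral_const, ha2]
        simp
    _ ≤ 1 / 2 * ((b / a * a ^ 2 + (b ^ 2 * 2) / (b / a)) / 2) := by gcongr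
    _ = 3 / 4 * (a * b) := by
        field_simp
        ring
    _ ≤ a * b := by nlinarith [mul_pos ha0 hb0]

end OutputDistance

/-! ### Exponential decay beyond the threshold depth. -/

theorem exists_exponential_rate {γ : ℝ} (h0 : 0 < γ) (h1 : γ ≤ 1) :
    ∃ c : ℝ, 0 < c ∧ ∀ n D : ℕ, 1 - 1 / Real.logb 2 (1 - γ / 2) < (D : ℝ) →
      (2 : ℝ) ^ ((n : ℝ) / 2) * (1 - γ / 2) ^ ((n : ℝ) * D / 2) ≤
        Real.exp (-(c * ((n : ℝ) * (D : ℝ)))) := by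
  have hq : 0 < 1 - γ / 2 := by linarith
  set L : ℝ := -Real.logb 2 (1 - γ / 2) with hL
  have hL0 : 0 < L := neg_pos.mpr (Real.logb_neg one_lt_two hq (by linarith))
  have hl2 : 0 < Real.log 2 := Real.log_pos one_lt_two
  have hlog : Real.log (1 - γ / 2) = -(L * Real.log 2) := by
    rw [hL, Real.logb]
    field_simp
  -- As 1 - γ/2 = 2^(-L), the left side is 2^(-(n/2)(LD - 1)). The threshold says LD > L + 1, so 1 <
  -- LD/(L + 1) and LD - 1 ≥ L²D/(L + 1), which gives this rate.
  refine ⟨Real.log 2 * L ^ 2 / (2 * (L + 1)), by positivity, fun n D hD => ?_⟩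
  have hD' : 1 + 1 / L < D := by
    have : Real.logb 2 (1 - γ / 2) = -L := by rw [hL, neg_neg]
    rw [this, div_neg, sub_neg_eq_add] at hD
    exact hD
  have hLD : L + 1 < D * L := by
    have := mul_lt_mul_of_pos_right hD' hL0
    rwa [add_mul, one_mul, one_div, inv_mul_cancel₀ hL0.ne'] at this
  rw [Real.rpow_def_of_pos two_pos, Real.rpow_def_of_pos hq, ← Real.exp_add, Real.exp_le_exp, hlog]
  have key : L ^ 2 / (L + 1) * D ≤ L * D - 1 := by
    rw [div_mul_eq_mul_div, div_le_iff₀ (by linarith)]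
    nlinarith
  have hn : 0 ≤ Real.log 2 * (n / 2) := by positivity
  have := mul_le_mul_of_nonneg_left key hn
  have e : Real.log 2 * L ^ 2 / (2 * (L + 1)) * (n * D) =
      Real.log 2 * (n / 2) * (L ^ 2 / (L + 1) * D) := by
    field_simp
  rw [e]
  linarith

theorem mainTheorem7 :
    ∃ C : ℝ, 0 < C ∧
      (∀ (γ : ℝ), 0 < γ → γ ≤ 1 →
        ∀ (σ : Matrix (Fin 2) (Fin 2) ℂ), IsQubitState σ →
        ∀ (n D : ℕ), 1 < D →
        ∀ (ψ φ : EuclideanSpace ℂ (Fin n → Fin 2)), ‖ψ‖ = 1 → ‖φ‖ = 1 → inner ℂ ψ φ = 0 →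
          Integrable (fun U : Fin D → QubitUnitary n => outputDistance γ σ ψ φ U)
            (randomGates n D) ∧
          ∫ U, outputDistance γ σ ψ φ U ∂(randomGates n D) ≤
            C * ((2 : ℝ) ^ ((n : ℝ) / 2) * (1 - γ / 2) ^ ((n : ℝ) * ((D : ℝ) - 1) / 2))) ∧
      (∀ (γ : ℝ), 0 < γ → γ ≤ 1 → ∃ c : ℝ, 0 < c ∧
        ∀ (σ : Matrix (Fin 2) (Fin 2) ℂ), IsQubitState σ →
        ∀ (n D : ℕ), 1 - 1 / Real.logb 2 (1 - γ / 2) < (D : ℝ) →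
        ∀ (ψ φ : EuclideanSpace ℂ (Fin n → Fin 2)), ‖ψ‖ = 1 → ‖φ‖ = 1 → inner ℂ ψ φ = 0 →
          ∫ U, outputDistance γ σ ψ φ U ∂(randomGates n D) ≤
            C * Real.exp (-(c * ((n : ℝ) * (D : ℝ))))) := by
  refine ⟨1, one_pos, fun γ h0 h1 σ hσ n D _ ψ φ hψ hφ h => ⟨?_, ?_⟩, fun γ h0 h1 => ?_⟩
  · exact (continuous_outputDistance D ψ φ).integrable_of_compactSpace
  · rw [one_mul]
    refine (integral_outputDistance_le hσ h0.le h1 D hψ hφ h).trans ?_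
    refine mul_le_mul_of_nonneg_left ?_ (Real.rpow_nonneg two_pos.le _)
    -- The base is at most 1, so lowering the exponent from nD/2 to n(D - 1)/2 weakens the bound.
    refine Real.rpow_le_rpow_of_exponent_ge (by linarith) (by linarith) ?_
    have : (0 : ℝ) ≤ n := n.cast_nonneg
    linarith
  · obtain ⟨c, hc, hbound⟩ := exists_exponential_rate h0 h1
    refine ⟨c, hc, fun σ hσ n D hD ψ φ hψ hφ h => ?_⟩
    rw [one_mul]
    exact (integral_outputDistance_le hσ h0.le h1 D hψ hφ h).trans (hbound n D hD)

end
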